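/- Let $E_1,E_2$ be (real) Banach lattices whose duals $E_1^*,E_2^*$ (with the dual order and the dual norm) have order continuous norms, that is, $\|f_\alpha\|\to 0$ for every net $f_\alpha\downarrow 0$ in $E_i^*$. Let $A\colon E_1\times E_2\to\mathbb{R}$ be a continuous bilinear form that is positive ($A(x,y)\ge 0$ for $x,y\ge 0$) and almost Dunford-Pettis: $A(x_n,y_n)\to 0$ whenever $(x_n)$ in $E_1$ and $(y_n)$ in $E_2$ are disjoint (pairwise disjoint) weakly null sequences. (Every positive bilinear form on a product of Banach lattices is automatically continuous.) Consider the two Aron-Berner extensions of $A$, the bilinear forms on $E_1^{**}\times E_2^{**}$ given by $$A^{***}(x^{**},y^{**})=x^{**}\big(x\mapsto y^{**}(A(x,\cdot))\big),\qquad AB^{\mathrm{id}}(A)(x^{**},y^{**})=y^{**}\big(y\mapsto x^{**}(A(\cdot,y))\big).$$ Then each $B\in\{A^{***},AB^{\mathrm{id}}(A)\}$ is weakly positively limited, that is: 1. $B(x_n^{**},y_n^{**})\to 0$ for every positive weak$^*$-null sequence $(x_n^{**})$ in $E_1^{**}$ and every positive norm bounded sequence $(y_n^{**})$ in $E_2^{**}$;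 2. $B(x_n^{**},y_n^{**})\to 0$ for every positive norm bounded sequence $(x_n^{**})$ in $E_1^{**}$ and every positive weak$^*$-null sequence $(y_n^{**})$ in $E_2^{**}$. Moreover, both extensions are almost Dunford-Pettis on $E_1^{**}\times E_2^{**}$: $B(x_n^{**},y_n^{**})\to 0$ for all disjoint weakly null sequences $(x_n^{**})$ in $E_1^{**}$ and $(y_n^{**})$ in $E_2^{**}$. -/

import Mathlib

open Filter Topology

set_option maxSynthPendingDepth 3
set_option linter.unusedSectionVars false

noncomputable section

namespace BanachLatticeDual

/-! ### The dual of a normed lattice as a normed lattice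

The topological dual of a real normed lattice `E` is ordered by `f ≤ g ↔ ∀ x ≥ 0, f x ≤ g x`.
The Riesz-Kantorovich formula `f⁺ x = sup {f u | 0 ≤ u ≤ x}` for `x ≥ 0` shows that it is a lattice,
and the operator norm is a lattice norm. -/

section Dual

variable {E : Type*} [NormedAddCommGroup E] [NormedSpace ℝ E] [Lattice E]
  [IsOrderedAddMonoid E] [HasSolidNorm E]

theorem ext_of_nonneg {f g : StrongDual ℝ E} (h : ∀ x : E, 0 ≤ x → f x = g x) : f = g := by
  ext x
  have h1 := h x⁺ (posPart_nonneg x)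
  have h2 := h x⁻ (negPart_nonneg x)
  rw [← posPart_sub_negPart x, map_sub, map_sub, h1, h2]

/-- The dual order: `f ≤ g` if and only if `f x ≤ g x` for every `x ≥ 0`. -/
instance instPartialOrder : PartialOrder (StrongDual ℝ E) where
  le f g := ∀ x : E, 0 ≤ x → f x ≤ g x
  le_refl _ _ _ := le_rfl
  le_trans _ _ _ h₁ h₂ x hx := (h₁ x hx).trans (h₂ x hx)
  le_antisymm _ _ h₁ h₂ := ext_of_nonneg fun x hx => le_antisymm (h₁ x hx) (h₂ x hx)

theorem le_iff {f g : StrongDual ℝ E} : f ≤ g ↔ ∀ x : E, 0 ≤ x → f x ≤ g x := Iff.rfl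

instance instIsOrderedAddMonoid : IsOrderedAddMonoid (StrongDual ℝ E) where
  add_le_add_left _ _ h c x hx := by
    simpa using h x hx

instance instIsOrderedModule : IsOrderedModule ℝ (StrongDual ℝ E) where
  smul_le_smul_of_nonneg_left c hc _ _ h x hx := by
    simpa using mul_le_mul_of_nonneg_left (h x hx) hc
  smul_le_smul_of_nonneg_right f hf _ _ h x hx := by
    have := hf x hx
    simpa using mul_le_mul_of_nonneg_right h this

/-- `supOn f x = sup {f u | 0 ≤ u ≤ x}`. -/
def supOn (f : StrongDual ℝ E) (x : E) : ℝ := sSup (f '' Set.Icc 0 x)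

theorem norm_le_of_mem {x u : E} (hu : u ∈ Set.Icc 0 x) : ‖u‖ ≤ ‖x‖ := by
  apply norm_le_norm_of_abs_le_abs
  rw [abs_of_nonneg hu.1, abs_of_nonneg (hu.1.trans hu.2)]
  exact hu.2

theorem apply_le (f : StrongDual ℝ E) {x u : E} (h : ‖u‖ ≤ ‖x‖) : f u ≤ ‖f‖ * ‖x‖ :=
  (le_abs_self _).trans ((f.le_opNorm u).trans (by gcongr))

theorem le_supOn (f : StrongDual ℝ E) {x u : E} (h0 : 0 ≤ u) (hu : u ≤ x) : f u ≤ supOn f x := by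
  refine le_csSup ⟨‖f‖ * ‖x‖, ?_⟩ ⟨u, ⟨h0, hu⟩, rfl⟩
  rintro _ ⟨v, hv, rfl⟩
  exact apply_le f (norm_le_of_mem hv)

theorem supOn_le (f : StrongDual ℝ E) {x : E} (hx : 0 ≤ x) {c : ℝ}
    (h : ∀ u, 0 ≤ u → u ≤ x → f u ≤ c) : supOn f x ≤ c := by
  refine csSup_le ⟨_, 0, ⟨le_rfl, hx⟩, rfl⟩ ?_
  rintro _ ⟨v, hv, rfl⟩
  exact h v hv.1 hv.2

theorem supOn_nonneg (f : StrongDual ℝ E) {x : E} (hx : 0 ≤ x) : 0 ≤ supOn f x := by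
  simpa using le_supOn f le_rfl hx

theorem supOn_add (f : StrongDual ℝ E) {x y : E} (hx : 0 ≤ x) (hy : 0 ≤ y) :
    supOn f (x + y) = supOn f x + supOn f y := by
  apply le_antisymm
  · refine supOn_le f (add_nonneg hx hy) fun u h0 hu => ?_
    have h1 : f (u ⊓ x) ≤ supOn f x := le_supOn f (le_inf h0 hx) inf_le_right
    have h2 : f (u - u ⊓ x) ≤ supOn f y := by
      refine le_supOn f (sub_nonneg.2 inf_le_left) ?_
      rw [sub_le_iff_le_add, add_comm y, ← sub_le_iff_le_add]
      exact le_inf ((sub_le_self_iff _).2 hy) (sub_le_iff_le_add.2 hu)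
    calc f u = f (u ⊓ x) + f (u - u ⊓ x) := by rw [← map_add]; congr 1; abel
      _ ≤ _ := add_le_add h1 h2
  · rw [← le_sub_iff_add_le]
    refine supOn_le f hx fun u h0 hu => ?_
    rw [le_sub_comm]
    refine supOn_le f hy fun v k0 hv => ?_
    rw [le_sub_iff_add_le, ← map_add]
    exact le_supOn f (add_nonneg k0 h0) (by rw [add_comm x]; exact add_le_add hv hu)

theorem supOn_sub (f : StrongDual ℝ E) {a b a' b' : E} (ha : 0 ≤ a) (hb : 0 ≤ b) (ha' : 0 ≤ a')
    (hb' : 0 ≤ b') (h : a - b = a' - b') :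
    supOn f a - supOn f b = supOn f a' - supOn f b' := by
  have h1 : a + b' = a' + b := by
    rw [sub_eq_sub_iff_add_eq_add] at h
    exact h
  have h2 := congrArg (supOn f) h1
  rw [supOn_add f ha hb', supOn_add f ha' hb] at h2
  linarith

/-- The positive part of a functional as an additive map. -/
def posHom (f : StrongDual ℝ E) : E →+ ℝ :=
  AddMonoidHom.mk' (fun x => supOn f x⁺ - supOn f x⁻) fun x y => by
    have hx := posPart_nonneg x
    have hy := posPart_nonneg y
    have hx' := negPart_nonneg x
    have hy' := negPart_nonneg y
    rw [supOn_sub f (posPart_nonneg (x + y)) (negPart_nonneg (x + y)) (add_nonneg hx hy)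
      (add_nonneg hx' hy'), supOn_add f hx hy, supOn_add f hx' hy']
    · ring
    · rw [posPart_sub_negPart, add_sub_add_comm, posPart_sub_negPart, posPart_sub_negPart]

theorem posHom_apply (f : StrongDual ℝ E) {x : E} (hx : 0 ≤ x) : posHom f x = supOn f x := by
  have h : supOn f (0 : E) = 0 := by
    have := supOn_add f (le_refl (0 : E)) le_rfl
    simp only [add_zero] at this
    linarith
  change supOn f x⁺ - supOn f x⁻ = _
  rw [posPart_eq_self.2 hx, negPart_eq_zero.2 hx, h, sub_zero]

theorem posHom_bound (f : StrongDual ℝ E) (x : E) : ‖posHom f x‖ ≤ ‖f‖ * ‖x‖ := by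
  have h1 : supOn f x⁺ ≤ ‖f‖ * ‖x‖ := by
    refine supOn_le f (posPart_nonneg x) fun u h0 hu => apply_le f ?_
    rw [← norm_abs_eq_norm x]
    exact norm_le_of_mem ⟨h0, hu.trans (by rw [← posPart_add_negPart]; simp)⟩
  have h2 : supOn f x⁻ ≤ ‖f‖ * ‖x‖ := by
    refine supOn_le f (negPart_nonneg x) fun u h0 hu => apply_le f ?_
    rw [← norm_abs_eq_norm x]
    exact norm_le_of_mem ⟨h0, hu.trans (by rw [← posPart_add_negPart]; simp)⟩
  have h3 := supOn_nonneg f (posPart_nonneg x)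
  have h4 := supOn_nonneg f (negPart_nonneg x)
  change |supOn f x⁺ - supOn f x⁻| ≤ _
  rw [abs_le]
  constructor <;> linarith

/-- The positive part `f ⊔ 0` of a functional (Riesz-Kantorovich). -/
def pos (f : StrongDual ℝ E) : StrongDual ℝ E :=
  (posHom f).toRealLinearMap (AddMonoidHomClass.continuous_of_bound _ ‖f‖ (posHom_bound f))

theorem pos_apply (f : StrongDual ℝ E) {x : E} (hx : 0 ≤ x) : pos f x = supOn f x :=
  posHom_apply f hx

theorem le_pos (f : StrongDual ℝ E) : f ≤ pos f := fun x hx => by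
  rw [pos_apply f hx]
  exact le_supOn f hx le_rfl

theorem pos_nonneg (f : StrongDual ℝ E) : 0 ≤ pos f := fun x hx => by
  rw [pos_apply f hx]
  exact supOn_nonneg f hx

theorem pos_le {f g : StrongDual ℝ E} (h : f ≤ g) (h0 : 0 ≤ g) : pos f ≤ g := fun x hx => by
  rw [pos_apply f hx]
  refine supOn_le f hx fun u hu hux => (h u hu).trans ?_
  have := h0 (x - u) (sub_nonneg.2 hux)
  simpa using this

/-- The lattice structure of the dual. The order is the one of `instPartialOrder`, so the lattice
operations are determined by it; the formulas below compute them. -/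
instance instLattice : Lattice (StrongDual ℝ E) where
  __ := instPartialOrder
  sup f g := g + pos (f - g)
  inf f g := f - pos (f - g)
  le_sup_left f g := by
    have := le_pos (f - g)
    rwa [sub_le_iff_le_add'] at this
  le_sup_right f g := le_add_of_nonneg_right (pos_nonneg _)
  sup_le f g k hf hg := by
    rw [← le_sub_iff_add_le']
    exact pos_le (sub_le_sub_right hf g) (sub_nonneg.2 hg)
  inf_le_left f g := sub_le_self _ (pos_nonneg _)
  inf_le_right f g := by
    have := le_pos (f - g)
    rwa [sub_le_comm] at this
  le_inf f g k hf hg := by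
    rw [le_sub_comm]
    exact pos_le (sub_le_sub_left hg g) (sub_nonneg.2 hf)

theorem abs_apply_le (f : StrongDual ℝ E) (x : E) : |f x| ≤ |f| |x| := by
  have key : ∀ g : StrongDual ℝ E, g x ≤ |g| |x| := fun g => by
    have h1 : g x⁺ ≤ |g| x⁺ := (le_abs_self g : g ≤ |g|) _ (posPart_nonneg x)
    have h2 : (-g) x⁻ ≤ |g| x⁻ := (neg_le_abs g : -g ≤ |g|) _ (negPart_nonneg x)
    have h3 : g x = g x⁺ - g x⁻ := by rw [← map_sub, posPart_sub_negPart]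
    rw [← posPart_add_negPart x, map_add, h3]
    simp only [neg_apply] at h2
    linarith
  refine abs_le'.2 ⟨key f, ?_⟩
  simpa using key (-f)

theorem abs_apply_le_norm (f : StrongDual ℝ E) {x : E} (hx : 0 ≤ x) : |f| x ≤ ‖f‖ * ‖x‖ := by
  have h : |f| = -f + pos (f - -f) := rfl
  rw [h, add_apply, pos_apply _ hx, neg_apply,
    ← le_sub_iff_add_le']
  refine supOn_le _ hx fun u h0 hu => ?_
  have h1 : |u + u - x| ≤ |x| := by
    rw [abs_of_nonneg hx]
    refine abs_le'.2 ⟨?_, ?_⟩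
    · rw [sub_le_iff_le_add]
      exact add_le_add hu hu
    · rw [neg_sub]
      exact sub_le_self _ (add_nonneg h0 h0)
  have h2 := apply_le f (norm_le_norm_of_abs_le_abs h1)
  rw [map_sub, map_add] at h2
  simp only [sub_apply, neg_apply]
  linarith

instance instHasSolidNorm : HasSolidNorm (StrongDual ℝ E) where
  solid f g h := by
    refine f.opNorm_le_bound (norm_nonneg g) fun x => ?_
    have h1 := abs_apply_le f x
    have h2 : |f| |x| ≤ |g| |x| := h _ (abs_nonneg x)
    have h3 := abs_apply_le_norm g (abs_nonneg x)
    rw [norm_abs_eq_norm] at h3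
    exact h1.trans (h2.trans h3)

end Dual

end BanachLatticeDual

/-! ### Order continuity, special sequences and classes of bilinear maps -/

/-- The norm of a normed lattice is order continuous: if a net decreases to `0`, then its norms tend
to `0`. A decreasing net is given by its range, a nonempty downward directed set; since the norm is
monotone on the positive cone, the norms tend to `0` if and only if they get arbitrarily small. -/
def HasOrderContinuousNorm (E : Type*) [NormedAddCommGroup E] [Lattice E] : Prop :=
  ∀ D : Set E, D.Nonempty → DirectedOn (fun x y => y ≤ x) D → IsGLB D 0 →
    ∀ ε : ℝ, 0 < ε → ∃ x ∈ D, ‖x‖ < ε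

/-- A sequence in a vector lattice whose terms are pairwise disjoint. -/
def IsDisjointSeq {E : Type*} [AddCommGroup E] [Lattice E] (x : ℕ → E) : Prop :=
  ∀ m n : ℕ, m ≠ n → |x m| ⊓ |x n| = 0

/-- A sequence that converges to `0` in the weak topology. -/
def IsWeaklyNull {E : Type*} [NormedAddCommGroup E] [NormedSpace ℝ E] (x : ℕ → E) : Prop :=
  ∀ f : StrongDual ℝ E, Tendsto (fun n => f (x n)) atTop (𝓝 0)

/-- A sequence of functionals that converges to `0` in the weak-star topology. -/
def IsWeakStarNull {E : Type*} [NormedAddCommGroup E] [NormedSpace ℝ E]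
    (f : ℕ → StrongDual ℝ E) : Prop :=
  ∀ x : E, Tendsto (fun n => f n x) atTop (𝓝 0)

/-- A norm bounded sequence. -/
def IsNormBoundedSeq {E : Type*} [NormedAddCommGroup E] (x : ℕ → E) : Prop :=
  ∃ M : ℝ, ∀ n, ‖x n‖ ≤ M

section Bilinear

variable {E₁ E₂ G : Type*}
  [NormedAddCommGroup E₁] [NormedSpace ℝ E₁] [Lattice E₁] [IsOrderedAddMonoid E₁] [HasSolidNorm E₁]
  [NormedAddCommGroup E₂] [NormedSpace ℝ E₂] [Lattice E₂] [IsOrderedAddMonoid E₂] [HasSolidNorm E₂]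
  [NormedAddCommGroup G] [NormedSpace ℝ G]

/-- A positive bilinear form. -/
def IsPositiveBilinForm (A : E₁ →L[ℝ] E₂ →L[ℝ] ℝ) : Prop :=
  ∀ (x : E₁) (y : E₂), 0 ≤ x → 0 ≤ y → 0 ≤ A x y

/-- An almost Dunford-Pettis bilinear operator: it sends pairs of disjoint weakly null sequences to
norm null sequences. -/
def IsAlmostDunfordPettis (A : E₁ →L[ℝ] E₂ →L[ℝ] G) : Prop :=
  ∀ (x : ℕ → E₁) (y : ℕ → E₂), IsDisjointSeq x → IsWeaklyNull x → IsDisjointSeq y →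
    IsWeaklyNull y → Tendsto (fun n => A (x n) (y n)) atTop (𝓝 0)

/-- A weakly positively limited bilinear operator on a product of dual Banach lattices: it sends a
positive weak-star null sequence in one variable (whichever it is), paired with a positive bounded
sequence in the other variable, to a norm null sequence. -/
def IsWeaklyPositivelyLimited (B : StrongDual ℝ E₁ →L[ℝ] StrongDual ℝ E₂ →L[ℝ] G) : Prop :=
  (∀ (f : ℕ → StrongDual ℝ E₁) (g : ℕ → StrongDual ℝ E₂), (∀ n, 0 ≤ f n) → (∀ n, 0 ≤ g n) →
    IsWeakStarNull f → IsNormBoundedSeq g → Tendsto (fun n => B (f n) (g n)) atTop (𝓝 0)) ∧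
  (∀ (f : ℕ → StrongDual ℝ E₁) (g : ℕ → StrongDual ℝ E₂), (∀ n, 0 ≤ f n) → (∀ n, 0 ≤ g n) →
    IsNormBoundedSeq f → IsWeakStarNull g → Tendsto (fun n => B (f n) (g n)) atTop (𝓝 0))

end Bilinear

/-! ### The two Aron-Berner extensions of a bilinear form -/

section AronBerner

variable {E₁ E₂ : Type*} [NormedAddCommGroup E₁] [NormedSpace ℝ E₁]
  [NormedAddCommGroup E₂] [NormedSpace ℝ E₂]

/-- The Aron-Berner extension for the transposition (the third Arens adjoint): the functional `y''`
acts first, then `x''`. See `aronBernerTransposition_apply` for the formula. -/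
def aronBernerTransposition (A : E₁ →L[ℝ] E₂ →L[ℝ] ℝ) :
    StrongDual ℝ (StrongDual ℝ E₁) →L[ℝ] StrongDual ℝ (StrongDual ℝ E₂) →L[ℝ] ℝ :=
  (ContinuousLinearMap.compL ℝ (StrongDual ℝ (StrongDual ℝ E₂)) (StrongDual ℝ E₁) ℝ).flip
    ((ContinuousLinearMap.compL ℝ E₁ (StrongDual ℝ E₂) ℝ).flip A)

/-- The value at `(x'', y'')` is `x''` applied to the functional `x ↦ y'' (A(x, ·))`. -/
theorem aronBernerTransposition_apply (A : E₁ →L[ℝ] E₂ →L[ℝ] ℝ)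
    (x'' : StrongDual ℝ (StrongDual ℝ E₁)) (y'' : StrongDual ℝ (StrongDual ℝ E₂)) :
    aronBernerTransposition A x'' y'' = x'' (y''.comp A) := rfl

/-- The Aron-Berner extension for the identity permutation: the functional `x''` acts first, then
`y''`. See `aronBernerIdentity_apply` for the formula. -/
def aronBernerIdentity (A : E₁ →L[ℝ] E₂ →L[ℝ] ℝ) :
    StrongDual ℝ (StrongDual ℝ E₁) →L[ℝ] StrongDual ℝ (StrongDual ℝ E₂) →L[ℝ] ℝ :=
  (aronBernerTransposition A.flip).flip

/-- The value at `(x'', y'')` is `y''` applied to the functional `y ↦ x'' (A(·, y))`. -/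
theorem aronBernerIdentity_apply (A : E₁ →L[ℝ] E₂ →L[ℝ] ℝ)
    (x'' : StrongDual ℝ (StrongDual ℝ E₁)) (y'' : StrongDual ℝ (StrongDual ℝ E₂)) :
    aronBernerIdentity A x'' y'' = y'' (x''.comp A.flip) := rfl

end AronBerner

end

/-! The core is a uniform domination property of `A`: for each `ε > 0` there is `u ≥ 0` in `E₁` with
`‖A (x - u)⁺‖ ≤ ε` for all positive `x` in the unit ball (`exists_norm_posPart_sub_le`), and
symmetrically some `v ≥ 0` in `E₂`. Up to `ε`, testing against the whole positive ball is then
testing against a single vector, which is what weak-star convergence controls.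

To get it, order continuity of the dual norms makes positive bounded disjoint sequences weakly null
(`isWeaklyNull_of_disjoint`). The almost Dunford-Pettis property then forces `‖A (x n)‖ → 0` along
disjoint sequences in the positive ball (`tendsto_norm_of_disjoint`). If domination failed, a
recursively chosen sequence of counterexamples could be made disjoint at small cost by
`exists_disjoint_minorant`, contradicting this. The same disjointification is already used for the
second variable in `tendsto_norm_of_disjoint`.

Domination passes to the bidual by positivity and gives weak positive limitedness of the first
extension; the second is the first extension of the flipped form. Finally, a disjoint weakly null
sequence in a bidual has weak-star null moduli (`isWeakStarNull_abs`), and `|B (x, y)| ≤ B (|x|,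
|y|)`, so the almost Dunford-Pettis property follows. -/

namespace BanachLatticeDual

/-! ### Positive functionals and disjointness in normed lattices -/

section NormedLattice

variable {E : Type*} [NormedAddCommGroup E] [NormedSpace ℝ E] [Lattice E]
  [IsOrderedAddMonoid E] [HasSolidNorm E]

/-- A bounded additive function on the positive cone extends to a continuous functional. -/
theorem exists_dual_of_additive (p : E → ℝ) (C : ℝ)
    (hadd : ∀ x y : E, 0 ≤ x → 0 ≤ y → p (x + y) = p x + p y)
    (h0 : ∀ x : E, 0 ≤ x → 0 ≤ p x) (hC : ∀ x : E, 0 ≤ x → p x ≤ C * ‖x‖) :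
    ∃ g : StrongDual ℝ E, ∀ x : E, 0 ≤ x → g x = p x := by
  have hsub : ∀ a b a' b' : E, 0 ≤ a → 0 ≤ b → 0 ≤ a' → 0 ≤ b' → a - b = a' - b' →
      p a - p b = p a' - p b' := by
    intro a b a' b' ha hb ha' hb' h
    have h1 : a + b' = a' + b := by rwa [sub_eq_sub_iff_add_eq_add] at h
    have h2 := congrArg p h1
    rw [hadd _ _ ha hb', hadd _ _ ha' hb] at h2
    linarith
  have hp0 : p 0 = 0 := by
    have := hadd 0 0 le_rfl le_rfl
    simp only [add_zero] at this
    linarith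
  let φ : E →+ ℝ := AddMonoidHom.mk' (fun x => p x⁺ - p x⁻) fun x y => by
    have hx := posPart_nonneg x
    have hy := posPart_nonneg y
    have hx' := negPart_nonneg x
    have hy' := negPart_nonneg y
    rw [hsub _ _ _ _ (posPart_nonneg (x + y)) (negPart_nonneg (x + y)) (add_nonneg hx hy)
      (add_nonneg hx' hy'), hadd _ _ hx hy, hadd _ _ hx' hy']
    · ring
    · rw [posPart_sub_negPart, add_sub_add_comm, posPart_sub_negPart, posPart_sub_negPart]
  have hφ : ∀ x, ‖φ x‖ ≤ |C| * ‖x‖ := by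
    intro x
    have key : ∀ u : E, 0 ≤ u → u ≤ |x| → p u ≤ |C| * ‖x‖ := fun u hu hux => by
      have h1 := norm_le_of_mem (x := |x|) ⟨hu, hux⟩
      rw [norm_abs_eq_norm] at h1
      calc p u ≤ C * ‖u‖ := hC u hu
        _ ≤ |C| * ‖u‖ := by gcongr; exact le_abs_self C
        _ ≤ |C| * ‖x‖ := by gcongr
    have h1 := key x⁺ (posPart_nonneg x) (by rw [← posPart_add_negPart]; simp)
    have h2 := key x⁻ (negPart_nonneg x) (by rw [← posPart_add_negPart]; simp)
    have h3 := h0 _ (posPart_nonneg x)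
    have h4 := h0 _ (negPart_nonneg x)
    change |p x⁺ - p x⁻| ≤ _
    rw [abs_le]
    constructor <;> linarith
  refine ⟨φ.toRealLinearMap (AddMonoidHomClass.continuous_of_bound _ |C| hφ), fun x hx => ?_⟩
  change p x⁺ - p x⁻ = _
  rw [posPart_eq_self.2 hx, negPart_eq_zero.2 hx, hp0, sub_zero]

/-- The norm of a positive functional is determined on the positive part of the unit ball. -/
theorem norm_le_of_nonneg {f : StrongDual ℝ E} (hf : 0 ≤ f) {C : ℝ} (hC : 0 ≤ C)
    (h : ∀ x : E, 0 ≤ x → ‖x‖ ≤ 1 → f x ≤ C) : ‖f‖ ≤ C := by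
  refine f.opNorm_le_of_unit_norm hC fun x hx => ?_
  have h1 := abs_apply_le f x
  rw [abs_of_nonneg hf] at h1
  exact h1.trans (h |x| (abs_nonneg x) (by rw [norm_abs_eq_norm, hx]))

/-- The restriction of a positive functional to an ideal, given by its positive cone `I`, extended
to be minimal off the ideal. -/
theorem exists_restrict {f : StrongDual ℝ E} (hf : 0 ≤ f) (I : Set E) (hI0 : (0 : E) ∈ I)
    (hadd : ∀ u ∈ I, ∀ v ∈ I, u + v ∈ I) (hsolid : ∀ u v : E, 0 ≤ u → u ≤ v → v ∈ I → u ∈ I) :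
    ∃ g : StrongDual ℝ E, ∀ x : E, 0 ≤ x → IsLUB (f '' {u | u ∈ I ∧ 0 ≤ u ∧ u ≤ x}) (g x) := by
  have hmono : ∀ u v : E, u ≤ v → f u ≤ f v := fun u v huv => by
    have := hf (v - u) (sub_nonneg.2 huv)
    simpa using this
  set S : E → Set ℝ := fun x => f '' {u | u ∈ I ∧ 0 ≤ u ∧ u ≤ x}
  have hlub : ∀ x : E, 0 ≤ x → IsLUB (S x) (sSup (S x)) := fun x hx => by
    refine isLUB_csSup ⟨_, 0, ⟨hI0, le_rfl, hx⟩, rfl⟩ ⟨f x, ?_⟩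
    rintro _ ⟨u, hu, rfl⟩
    exact hmono _ _ hu.2.2
  suffices h : ∃ g : StrongDual ℝ E, ∀ x : E, 0 ≤ x → g x = sSup (S x) by
    obtain ⟨g, hg⟩ := h
    exact ⟨g, fun x hx => by rw [hg x hx]; exact hlub x hx⟩
  refine exists_dual_of_additive (fun x => sSup (S x)) ‖f‖ ?_ ?_ ?_
  · intro x y hx hy
    apply le_antisymm
    -- Riesz decomposition: `u ≤ x + y` splits into `u ⊓ x ≤ x` and `u - u ⊓ x ≤ y`, and solidity
    -- keeps both pieces in `I`.
    · refine (hlub _ (add_nonneg hx hy)).2 ?_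
      rintro _ ⟨u, ⟨hu, h0, hxy⟩, rfl⟩
      have h1 : f (u ⊓ x) ≤ sSup (S x) := (hlub x hx).1
        ⟨_, ⟨hsolid _ _ (le_inf h0 hx) inf_le_left hu, le_inf h0 hx, inf_le_right⟩, rfl⟩
      have h2 : f (u - u ⊓ x) ≤ sSup (S y) := by
        have h0' : 0 ≤ u - u ⊓ x := sub_nonneg.2 inf_le_left
        refine (hlub y hy).1 ⟨_, ⟨hsolid _ _ h0' (sub_le_self _ (le_inf h0 hx)) hu, h0', ?_⟩, rfl⟩
        rw [sub_le_iff_le_add, add_comm y, ← sub_le_iff_le_add]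
        exact le_inf ((sub_le_self_iff _).2 hy) (sub_le_iff_le_add.2 hxy)
      calc f u = f (u ⊓ x) + f (u - u ⊓ x) := by rw [← map_add]; congr 1; abel
        _ ≤ _ := add_le_add h1 h2
    · rw [← le_sub_iff_add_le]
      refine (hlub x hx).2 ?_
      rintro _ ⟨u, ⟨hu, hu0, hux⟩, rfl⟩
      rw [le_sub_comm]
      refine (hlub y hy).2 ?_
      rintro _ ⟨v, ⟨hv, hv0, hvy⟩, rfl⟩
      rw [le_sub_iff_add_le, ← map_add]
      refine (hlub _ (add_nonneg hx hy)).1 ⟨_, ⟨hadd _ hv _ hu, add_nonneg hv0 hu0, ?_⟩, rfl⟩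
      rw [add_comm x]
      exact add_le_add hvy hux
  · intro x hx
    exact (hlub x hx).1 ⟨0, ⟨hI0, le_rfl, hx⟩, map_zero f⟩
  · intro x hx
    refine (hlub x hx).2 ?_
    rintro _ ⟨u, hu, rfl⟩
    exact apply_le f (norm_le_of_mem hu.2)

theorem inf_eq_zero_of_le {a b c d : E} (ha : 0 ≤ a) (hb : 0 ≤ b) (hac : a ≤ c) (hbd : b ≤ d)
    (h : c ⊓ d = 0) : a ⊓ b = 0 :=
  le_antisymm (h ▸ inf_le_inf hac hbd) (le_inf ha hb)

/-- Subtracting `c` from the left side leaves a vector below both `a` and `b`, hence below `0`. -/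
theorem inf_add_le_of_inf_eq_zero {a b c : E} (hc : 0 ≤ c) (h : a ⊓ b = 0) :
    a ⊓ (b + c) ≤ a ⊓ c := by
  refine le_inf inf_le_left ?_
  have h1 : a ⊓ (b + c) - c ≤ a ⊓ b := by
    refine le_inf ((sub_le_self _ hc).trans inf_le_left) ?_
    rw [sub_le_iff_le_add]
    exact inf_le_right
  rw [h] at h1
  exact sub_nonpos.1 h1

/-- A finite sum of positive vectors disjoint from `a` is disjoint from `a`. -/
theorem inf_sum_eq_zero {a : E} (ha : 0 ≤ a) {ι : Type*} (s : Finset ι) (b : ι → E)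
    (hb : ∀ i ∈ s, 0 ≤ b i) (h : ∀ i ∈ s, a ⊓ b i = 0) : a ⊓ ∑ i ∈ s, b i = 0 := by
  classical
  induction s using Finset.induction_on with
  | empty => simpa using ha
  | insert i s hi ih =>
    have h1 := ih (fun j hj => hb j (Finset.mem_insert_of_mem hj))
      (fun j hj => h j (Finset.mem_insert_of_mem hj))
    have h2 : 0 ≤ ∑ i ∈ s, b i := Finset.sum_nonneg fun j hj => hb j (Finset.mem_insert_of_mem hj)
    refine le_antisymm ?_ (le_inf ha (Finset.sum_nonneg hb))
    rw [Finset.sum_insert hi]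
    exact (inf_add_le_of_inf_eq_zero h2 (h i (Finset.mem_insert_self _ _))).trans h1.le

/-- For disjoint vectors the sum of the moduli is their supremum, so it suffices to bound each one.
In `|a| ≤ |b| + |a + b|` the term `|b|`, disjoint from `|a|`, can be dropped. -/
theorem abs_add_abs_le_of_inf_eq_zero {a b : E} (h : |a| ⊓ |b| = 0) : |a| + |b| ≤ |a + b| := by
  have key : ∀ a b : E, |a| ⊓ |b| = 0 → |a| ≤ |a + b| := fun a b h => by
    have h1 : |a| ≤ |b| + |a + b| := by
      have h2 := abs_add_le (-b) (a + b)
      rwa [abs_neg, neg_add_cancel_comm_assoc] at h2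
    exact (le_inf le_rfl h1).trans
      ((inf_add_le_of_inf_eq_zero (abs_nonneg _) h).trans inf_le_right)
  rw [← inf_add_sup, h, zero_add]
  refine sup_le (key a b h) ?_
  rw [add_comm]
  exact key b a (by rwa [inf_comm])

/-- The triangle inequality is reversed for pairwise disjoint vectors. -/
theorem sum_abs_le_abs_sum {ι : Type*} (s : Finset ι) (b : ι → E)
    (h : ∀ i ∈ s, ∀ j ∈ s, i ≠ j → |b i| ⊓ |b j| = 0) : ∑ i ∈ s, |b i| ≤ |∑ i ∈ s, b i| := by
  classical
  induction s using Finset.induction_on with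
  | empty => simp
  | insert i s hi ih =>
    rw [Finset.sum_insert hi, Finset.sum_insert hi]
    have h1 : |b i| ⊓ ∑ j ∈ s, |b j| = 0 := by
      refine inf_sum_eq_zero (abs_nonneg _) s _ (fun j _ => abs_nonneg _) fun j hj => ?_
      refine h i (Finset.mem_insert_self _ _) j (Finset.mem_insert_of_mem hj) ?_
      rintro rfl
      exact hi hj
    have h2 : |b i| ⊓ |∑ j ∈ s, b j| = 0 :=
      inf_eq_zero_of_le (abs_nonneg _) (abs_nonneg _) le_rfl
        (Finset.le_sum_of_subadditive _ abs_zero.le abs_add_le s b) h1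
    refine le_trans (add_le_add_right (ih fun j hj k hk => ?_) _)
      (abs_add_abs_le_of_inf_eq_zero h2)
    exact h j (Finset.mem_insert_of_mem hj) k (Finset.mem_insert_of_mem hk)

theorem IsDisjointSeq.inf_eq_zero {x : ℕ → E} (hd : IsDisjointSeq x) (h0 : ∀ n, 0 ≤ x n) {m n : ℕ}
    (h : m ≠ n) : x m ⊓ x n = 0 := by
  have := hd m n h
  rwa [abs_of_nonneg (h0 m), abs_of_nonneg (h0 n)] at this

/-! ### Bounded disjoint sequences and disjointification -/

variable [CompleteSpace E]

/-- If the dual norm is order continuous, then positive functionals tend to `0` along positive norm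
bounded disjoint sequences. -/
theorem tendsto_of_disjoint_of_nonneg (hE : HasOrderContinuousNorm (StrongDual ℝ E)) {x : ℕ → E}
    (h0 : ∀ n, 0 ≤ x n) (hd : IsDisjointSeq x) {M : ℝ} (hM : ∀ n, ‖x n‖ ≤ M)
    {f : StrongDual ℝ E} (hf : 0 ≤ f) : Tendsto (fun n => f (x n)) atTop (𝓝 0) := by
  -- On its positive part, `I N` is the ideal generated by the tail `x i`, `i ≥ N`. The restrictions
  -- `g N` of `f` to these ideals decrease, agree with `f` on the tail and vanish at the earlier
  -- terms.
  let I : ℕ → Set E := fun N =>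
    {u | ∃ k m : ℕ, u ≤ k • ∑ i ∈ Finset.Ico N m, x i}
  have hsum0 : ∀ N m : ℕ, 0 ≤ ∑ i ∈ Finset.Ico N m, x i := fun N m =>
    Finset.sum_nonneg fun i _ => h0 i
  have hImono : ∀ N, I (N + 1) ⊆ I N := by
    rintro N u ⟨k, m, hu⟩
    refine ⟨k, m, hu.trans (nsmul_le_nsmul_right ?_ k)⟩
    exact Finset.sum_le_sum_of_subset_of_nonneg (Finset.Ico_subset_Ico_left N.le_succ)
      fun i _ _ => h0 i
  have hI : ∀ N, ∃ g : StrongDual ℝ E, ∀ y : E, 0 ≤ y →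
      IsLUB (f '' {u | u ∈ I N ∧ 0 ≤ u ∧ u ≤ y}) (g y) := by
    intro N
    refine exists_restrict hf (I N) ⟨0, 0, by simp⟩ ?_ ?_
    · rintro u ⟨k, m, hu⟩ v ⟨l, n, hv⟩
      refine ⟨k + l, max m n, ?_⟩
      rw [add_nsmul]
      refine add_le_add (hu.trans ?_) (hv.trans ?_) <;> refine nsmul_le_nsmul_right ?_ _ <;>
        refine Finset.sum_le_sum_of_subset_of_nonneg (Finset.Ico_subset_Ico_right ?_)
          fun i _ _ => h0 i
      · exact le_max_left _ _
      · exact le_max_right _ _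
    · rintro u v - huv ⟨k, m, hv⟩
      exact ⟨k, m, huv.trans hv⟩
  choose g hg using hI
  have hg0 : ∀ N, 0 ≤ g N := fun N y hy =>
    (hg N y hy).1 ⟨0, ⟨⟨0, 0, by simp⟩, le_rfl, hy⟩, map_zero f⟩
  have hganti : Antitone g := antitone_nat_of_succ_le fun N y hy =>
    (hg (N + 1) y hy).mono (hg N y hy)
      (Set.image_mono fun u hu => ⟨hImono N hu.1, hu.2⟩)
  have hgx : ∀ N, f (x N) ≤ g N (x N) := fun N =>
    (hg N _ (h0 N)).1 ⟨x N, ⟨⟨1, N + 1, by simp⟩, h0 N, le_rfl⟩, rfl⟩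
  have hgx' : ∀ N n, n < N → g N (x n) ≤ 0 := by
    intro N n hn
    refine (hg N _ (h0 n)).2 ?_
    rintro _ ⟨u, ⟨⟨k, m, hu⟩, hu0, hux⟩, rfl⟩
    have h1 : x n ⊓ k • ∑ i ∈ Finset.Ico N m, x i = 0 := by
      rw [← Finset.card_range k, ← Finset.sum_const]
      refine inf_sum_eq_zero (h0 n) _ _ (fun _ _ => hsum0 N m) fun _ _ => ?_
      refine inf_sum_eq_zero (h0 n) _ _ (fun i _ => h0 i) fun i hi => ?_
      exact IsDisjointSeq.inf_eq_zero hd h0 (hn.trans_le (Finset.mem_Ico.1 hi).1).ne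
    have h2 : u = 0 := le_antisymm (h1 ▸ le_inf hux hu) hu0
    rw [h2, map_zero]
  have hconv0 : ∀ y : E, 0 ≤ y → Tendsto (fun N => g N y) atTop (𝓝 (⨅ N, g N y)) := fun y hy =>
    tendsto_atTop_ciInf (fun _ _ h => hganti h y hy)
      ⟨0, by rintro _ ⟨N, rfl⟩; exact hg0 N y hy⟩
  have hconv : ∀ y : E, ∃ c, Tendsto (fun N => g N y) atTop (𝓝 c) := fun y => by
    refine ⟨_, ((hconv0 _ (posPart_nonneg y)).sub (hconv0 _ (negPart_nonneg y))).congr fun N => ?_⟩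
    rw [← map_sub, posPart_sub_negPart]
  choose c hc using hconv
  -- The pointwise limit is continuous by uniform boundedness, so completeness of `E` enters here.
  -- It is nonpositive at every `x n`, and order continuity makes `‖g N - h‖` small, whence `f (x n)
  -- ≤ (g N - h) (x n)` is small for `n ≥ N`.
  let h : StrongDual ℝ E := continuousLinearMapOfTendsto (g := fun N => g N) (tendsto_pi_nhds.2 hc)
  have hh : ∀ y, Tendsto (fun N => g N y) atTop (𝓝 (h y)) := hc
  have hhle : ∀ N, h ≤ g N := fun N y hy =>
    le_of_tendsto (hh y) ((eventually_ge_atTop N).mono fun K hK => hganti hK y hy)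
  have hhx : ∀ n, h (x n) ≤ 0 := fun n =>
    le_of_tendsto (hh (x n)) ((eventually_gt_atTop n).mono fun K hK => hgx' K n hK)
  rw [Metric.tendsto_atTop]
  intro ε hε
  have hM0 : 0 ≤ M := (norm_nonneg _).trans (hM 0)
  have hdir : DirectedOn (fun x y => y ≤ x) (Set.range fun N => g N - h) := by
    rintro _ ⟨N, rfl⟩ _ ⟨K, rfl⟩
    exact ⟨_, ⟨max N K, rfl⟩, sub_le_sub_right (hganti (le_max_left _ _)) h,
      sub_le_sub_right (hganti (le_max_right _ _)) h⟩
  have hglb : IsGLB (Set.range fun N => g N - h) 0 := by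
    refine ⟨?_, fun k hk y hy => ?_⟩
    · rintro _ ⟨N, rfl⟩
      exact sub_nonneg.2 (hhle N)
    · have h1 : Tendsto (fun N => (g N - h) y) atTop (𝓝 0) := by
        simpa using (hh y).sub_const (h y)
      exact ge_of_tendsto' h1 fun N => hk ⟨N, rfl⟩ y hy
  obtain ⟨N, hN⟩ : ∃ N, ‖g N - h‖ < ε / (M + 1) := by
    simpa using hE (Set.range fun N => g N - h) (Set.range_nonempty _) hdir hglb
      (ε / (M + 1)) (by positivity)
  refine ⟨N, fun n hn => ?_⟩
  have h3 : 0 ≤ f (x n) := hf _ (h0 n)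
  rw [Real.dist_eq, sub_zero, abs_of_nonneg h3]
  have h4 := hgx n
  have h5 : g n (x n) ≤ g N (x n) := hganti hn _ (h0 n)
  have h6 := (le_abs_self _).trans ((g N - h).le_opNorm (x n))
  rw [sub_apply] at h6
  have h7 := hhx n
  have h8 : ‖g N - h‖ * ‖x n‖ ≤ ‖g N - h‖ * (M + 1) := by
    gcongr
    linarith [hM n]
  have h9 : ‖g N - h‖ * (M + 1) < ε := by
    rwa [lt_div_iff₀ (by positivity)] at hN
  linarith

/-- If the dual norm is order continuous, then positive norm bounded disjoint sequences are weakly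
null. -/
theorem isWeaklyNull_of_disjoint (hE : HasOrderContinuousNorm (StrongDual ℝ E)) {x : ℕ → E}
    (h0 : ∀ n, 0 ≤ x n) (hd : IsDisjointSeq x) {M : ℝ} (hM : ∀ n, ‖x n‖ ≤ M) :
    IsWeaklyNull x := fun f => by
  have h1 := tendsto_of_disjoint_of_nonneg hE h0 hd hM (posPart_nonneg f)
  have h2 := tendsto_of_disjoint_of_nonneg hE h0 hd hM (negPart_nonneg f)
  have h3 := h1.sub h2
  rw [sub_zero] at h3
  refine h3.congr fun n => ?_
  rw [← sub_apply, posPart_sub_negPart]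

/-- A positive norm bounded sequence dominates a disjoint sequence, up to multiples of the previous
terms and a small error. -/
theorem exists_disjoint_minorant [IsOrderedModule ℝ E] {y : ℕ → E} (h0 : ∀ n, 0 ≤ y n)
    {M : ℝ} (hM : ∀ n, ‖y n‖ ≤ M) :
    ∃ (v : ℕ → E) (w : E), (∀ n, 0 ≤ v n) ∧ (∀ n, v n ≤ y n) ∧ IsDisjointSeq v ∧
      ∀ n, (y n - (4 : ℝ) ^ n • ∑ i ∈ Finset.range n, y i)⁺ ≤ v n + (1 / 2 : ℝ) ^ n • w := by
  have hs : Summable fun n => (1 / 2 : ℝ) ^ n • y n := by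
    refine Summable.of_norm_bounded (summable_geometric_two.mul_right M) fun n => ?_
    rw [norm_smul, norm_pow]
    norm_num
    exact hM n
  set w := ∑' n, (1 / 2 : ℝ) ^ n • y n with hw
  have hterm : ∀ n, 0 ≤ (1 / 2 : ℝ) ^ n • y n := fun n => smul_nonneg (by positivity) (h0 n)
  have hyw : ∀ n, (1 / 2 : ℝ) ^ n • y n ≤ w := fun n => hs.le_tsum n fun i _ => hterm i
  have hw0 : 0 ≤ w := (hterm 0).trans (hyw 0)
  set s : ℕ → E := fun n => (4 : ℝ) ^ n • ∑ i ∈ Finset.range n, y i with hs_def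
  have hs0 : ∀ n, 0 ≤ s n := fun n =>
    smul_nonneg (by positivity) (Finset.sum_nonneg fun i _ => h0 i)
  have hw0' : ∀ n, 0 ≤ (1 / 2 : ℝ) ^ n • w := fun n => smul_nonneg (by positivity) hw0
  -- Subtracting `s n` makes `v n` disjoint from the earlier terms; subtracting the multiple of `w`
  -- makes it disjoint from the later ones.
  set v : ℕ → E := fun n => (y n - s n - (1 / 2 : ℝ) ^ n • w)⁺ with hv
  have hv0 : ∀ n, 0 ≤ v n := fun n => posPart_nonneg _
  have key : ∀ i n, i < n → v i ⊓ v n = 0 := by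
    intro i n hin
    -- With this `c`, `c⁻¹ • y n` is below the multiple of `w` subtracted in `v i`, and `c ≤ 4 ^ n`
    -- because `i < n`, so `c • y i` is below `s n`. Thus `v i` and `v n` are dominated by multiples
    -- of `a⁻` and `a⁺`.
    set c : ℝ := 2 ^ (i + n) with hc
    set a := c⁻¹ • y n - y i with ha
    have h1 : v i ≤ (-a)⁺ := by
      refine posPart_mono ?_
      rw [ha, neg_sub, sub_sub]
      refine sub_le_sub_left ?_ _
      have h2 : c⁻¹ • y n ≤ (1 / 2 : ℝ) ^ i • w := by
        have : c⁻¹ • y n = (1 / 2 : ℝ) ^ i • ((1 / 2 : ℝ) ^ n • y n) := by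
          rw [smul_smul, ← pow_add, hc, one_div, inv_pow]
        rw [this]
        exact smul_le_smul_of_nonneg_left (hyw n) (by positivity)
      exact h2.trans (le_add_of_nonneg_left (hs0 i))
    have h2 : v n ≤ c • a⁺ := by
      have hca : c • a = y n - c • y i := by
        rw [ha, smul_sub, smul_smul, mul_inv_cancel₀ (by positivity), one_smul]
      refine sup_le ?_ (smul_nonneg (by positivity) (posPart_nonneg _))
      refine le_trans ?_ (smul_le_smul_of_nonneg_left (le_posPart a) (by positivity : 0 ≤ c))
      rw [hca, sub_sub]
      refine sub_le_sub_left ?_ _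
      refine le_trans ?_ (le_add_of_nonneg_right (hw0' n))
      have h3 : c • y i ≤ (4 : ℝ) ^ n • y i := by
        refine smul_le_smul_of_nonneg_right ?_ (h0 i)
        rw [hc, show (4 : ℝ) = 2 ^ 2 by norm_num, ← pow_mul]
        exact pow_le_pow_right₀ (by norm_num) (by omega)
      refine h3.trans (smul_le_smul_of_nonneg_left ?_ (by positivity))
      exact Finset.single_le_sum (fun j _ => h0 j) (Finset.mem_range.2 hin)
    have hc1 : 1 ≤ c := one_le_pow₀ (by norm_num)
    have h3 : (-a)⁺ ≤ c • a⁻ := by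
      rw [posPart_neg]
      simpa using smul_le_smul_of_nonneg_right hc1 (negPart_nonneg a)
    refine inf_eq_zero_of_le (hv0 i) (hv0 n) (h1.trans h3) h2 ?_
    have h4 : c • (a⁻ ⊓ a⁺) = c • a⁻ ⊓ c • a⁺ :=
      (OrderIso.smulRight (zero_lt_one.trans_le hc1)).map_inf a⁻ a⁺
    rw [← h4, inf_comm, posPart_inf_negPart_eq_zero, smul_zero]
  refine ⟨v, w, hv0, fun n => ?_, fun m n hmn => ?_, fun n => ?_⟩
  · refine sup_le ?_ (h0 n)
    rw [sub_sub]
    exact sub_le_self _ (add_nonneg (hs0 n) (hw0' n))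
  · rw [abs_of_nonneg (hv0 m), abs_of_nonneg (hv0 n)]
    rcases hmn.lt_or_gt with h | h
    · exact key m n h
    · rw [inf_comm]; exact key n m h
  · refine sup_le ?_ (add_nonneg (hv0 n) (hw0' n))
    rw [← sub_le_iff_le_add]
    exact le_posPart _

end NormedLattice

theorem tendsto_zero_of_le_add {a : ℕ → ℝ} (h0 : ∀ n, 0 ≤ a n) (C : ℝ)
    (h : ∀ ε : ℝ, 0 < ε → ∃ b : ℕ → ℝ, Tendsto b atTop (𝓝 0) ∧ ∀ n, a n ≤ b n + C * ε) :
    Tendsto a atTop (𝓝 0) := by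
  rw [Metric.tendsto_atTop]
  intro ε hε
  obtain ⟨b, hb, hab⟩ := h (ε / (2 * (|C| + 1))) (by positivity)
  obtain ⟨N, hN⟩ := (hb.eventually_lt_const (half_pos hε)).exists_forall_of_atTop
  refine ⟨N, fun n hn => ?_⟩
  rw [Real.dist_eq, sub_zero, abs_of_nonneg (h0 n)]
  have h1 : C * (ε / (2 * (|C| + 1))) ≤ ε / 2 := by
    rw [mul_div_assoc', div_le_div_iff₀ (by positivity) (by positivity)]
    nlinarith [le_abs_self C]
  linarith [hN n hn, hab n]

/-! ### Domination for positive almost Dunford-Pettis forms -/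

section Bilinear

variable {E₁ E₂ : Type*}
  [NormedAddCommGroup E₁] [NormedSpace ℝ E₁] [Lattice E₁] [IsOrderedAddMonoid E₁]
  [HasSolidNorm E₁]
  [NormedAddCommGroup E₂] [NormedSpace ℝ E₂] [Lattice E₂] [IsOrderedAddMonoid E₂]
  [HasSolidNorm E₂]

theorem IsPositiveBilinForm.flip {A : E₁ →L[ℝ] E₂ →L[ℝ] ℝ} (h : IsPositiveBilinForm A) :
    IsPositiveBilinForm A.flip := fun x y hx hy => h y x hy hx

theorem IsAlmostDunfordPettis.flip {A : E₁ →L[ℝ] E₂ →L[ℝ] ℝ} (h : IsAlmostDunfordPettis A) :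
    IsAlmostDunfordPettis A.flip := fun x y hx hx' hy hy' => h y x hy hy' hx hx'

theorem IsPositiveBilinForm.mono_left {A : E₁ →L[ℝ] E₂ →L[ℝ] ℝ} (h : IsPositiveBilinForm A)
    {x x' : E₁} (hx : x ≤ x') : A x ≤ A x' := fun y hy => by
  have := h (x' - x) y (sub_nonneg.2 hx) hy
  simpa using this

theorem IsPositiveBilinForm.mono_right {A : E₁ →L[ℝ] E₂ →L[ℝ] ℝ} (h : IsPositiveBilinForm A)
    {x : E₁} (hx : 0 ≤ x) {y y' : E₂} (hy : y ≤ y') : A x y ≤ A x y' :=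
  IsPositiveBilinForm.mono_left (IsPositiveBilinForm.flip h) hy x hx

/-- A positive almost Dunford-Pettis form sends disjoint sequences in the positive part of the
unit ball to norm null sequences of functionals. -/
theorem tendsto_norm_of_disjoint [CompleteSpace E₁] [CompleteSpace E₂] [IsOrderedModule ℝ E₂]
    (h₁ : HasOrderContinuousNorm (StrongDual ℝ E₁)) (h₂ : HasOrderContinuousNorm (StrongDual ℝ E₂))
    {A : E₁ →L[ℝ] E₂ →L[ℝ] ℝ} (hpos : IsPositiveBilinForm A) (hA : IsAlmostDunfordPettis A)
    {x : ℕ → E₁} (h0 : ∀ n, 0 ≤ x n) (hd : IsDisjointSeq x) (hx : ∀ n, ‖x n‖ ≤ 1) :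
    Tendsto (fun n => ‖A (x n)‖) atTop (𝓝 0) := by
  by_contra hcon
  rw [Metric.tendsto_atTop] at hcon
  push Not at hcon
  obtain ⟨ε, hε, hcon⟩ := hcon
  have hnull := isWeaklyNull_of_disjoint h₁ h0 hd hx
  -- Weak nullness of `x` makes `A (x n) s` small for late `n`, while `‖A (x n)‖ ≥ ε` for some such
  -- `n` yields a positive `y` in the ball that nearly norms it.
  have hchoice : ∀ (N : ℕ) (s : E₂), ∃ (n : ℕ) (y : E₂), N ≤ n ∧ 0 ≤ y ∧ ‖y‖ ≤ 1 ∧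
      ε / 2 ≤ A (x n) y ∧ A (x n) s ≤ ε / 8 := by
    intro N s
    obtain ⟨K, hK⟩ := ((hnull (A.flip s)).eventually_lt_const
      (by positivity : 0 < ε / 8)).exists_forall_of_atTop
    obtain ⟨n, hn, hnε⟩ := hcon (max N K)
    rw [Real.dist_eq, sub_zero, abs_norm] at hnε
    by_contra hy
    push Not at hy
    have hle : ‖A (x n)‖ ≤ ε / 2 := by
      refine norm_le_of_nonneg (hpos (x n) · (h0 n)) (by positivity) fun y hy0 hy1 => ?_
      by_contra hlt
      have h3 := hy n y ((le_max_left _ _).trans hn) hy0 hy1 (not_le.1 hlt).le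
      exact lt_asymm h3 (hK n ((le_max_right _ _).trans hn))
    linarith
  choose n y hNn hy0 hy1 hAy hAs using hchoice
  -- The state is a lower bound for the next index and the sum of the vectors chosen so far; the `+
  -- 1` makes the indices strictly increasing.
  let P : ℕ → ℕ × E₂ := fun k => Nat.rec (0, 0)
    (fun k p => (n p.1 ((4 : ℝ) ^ k • p.2) + 1, p.2 + y p.1 ((4 : ℝ) ^ k • p.2))) k
  let m : ℕ → ℕ := fun k => n (P k).1 ((4 : ℝ) ^ k • (P k).2)
  let Y : ℕ → E₂ := fun k => y (P k).1 ((4 : ℝ) ^ k • (P k).2)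
  have hsum : ∀ k, (P k).2 = ∑ i ∈ Finset.range k, Y i := by
    intro k
    induction k with
    | zero => rfl
    | succ k ih => rw [Finset.sum_range_succ, ← ih]
  have hm : StrictMono m := strictMono_nat_of_lt_succ fun k =>
    (hNn (P (k + 1)).1 ((4 : ℝ) ^ (k + 1) • (P (k + 1)).2) : m k + 1 ≤ _)
  have hY0 : ∀ k, 0 ≤ Y k := fun k => hy0 _ _
  obtain ⟨v, w, hv0, hvY, hvd, hvw⟩ :=
    exists_disjoint_minorant hY0 (fun k => hy1 _ _ : ∀ k, ‖Y k‖ ≤ 1)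
  have hv1 : ∀ k, ‖v k‖ ≤ 1 := fun k => (norm_le_of_mem ⟨hv0 k, hvY k⟩).trans (hy1 _ _)
  have hlim := hA (fun k => x (m k)) v (fun i j hij => hd _ _ (hm.injective.ne hij))
    (fun f => (hnull f).comp hm.tendsto_atTop) hvd (isWeaklyNull_of_disjoint h₂ hv0 hvd hv1)
  have hlim2 : Tendsto (fun k => (1 / 2 : ℝ) ^ k * A (x (m k)) w) atTop (𝓝 0) := by
    simpa using (tendsto_pow_atTop_nhds_zero_of_lt_one (by norm_num)
      (by norm_num : (1 / 2 : ℝ) < 1)).mul ((hnull (A.flip w)).comp hm.tendsto_atTop)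
  -- The bound is `ε / 2 - ε / 8`: the value at `Y k` less the contribution of the earlier vectors.
  have hge : ∀ k, 3 * ε / 8 ≤ A (x (m k)) (v k) + (1 / 2 : ℝ) ^ k * A (x (m k)) w := by
    intro k
    have e1 : ε / 2 ≤ A (x (m k)) (Y k) := hAy _ _
    have e2 : A (x (m k)) ((4 : ℝ) ^ k • ∑ i ∈ Finset.range k, Y i) ≤ ε / 8 := by
      rw [← hsum]; exact hAs _ _
    have e3 := IsPositiveBilinForm.mono_right hpos (h0 (m k)) ((le_posPart _).trans (hvw k))
    rw [map_sub, map_add, map_smul _ _ w, smul_eq_mul] at e3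
    linarith
  have hlim3 := hlim.add hlim2
  have := ge_of_tendsto' hlim3 hge
  linarith

/-- If a positive form sends disjoint sequences in the positive part of the unit ball to norm null
sequences, then the positive part of the unit ball is almost order bounded with respect to it. -/
theorem exists_norm_posPart_sub_le [CompleteSpace E₁] [IsOrderedModule ℝ E₁]
    {A : E₁ →L[ℝ] E₂ →L[ℝ] ℝ} (hpos : IsPositiveBilinForm A)
    (h : ∀ x : ℕ → E₁, (∀ n, 0 ≤ x n) → IsDisjointSeq x → (∀ n, ‖x n‖ ≤ 1) →
      Tendsto (fun n => ‖A (x n)‖) atTop (𝓝 0)) {ε : ℝ} (hε : 0 < ε) :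
    ∃ u : E₁, 0 ≤ u ∧ ∀ x : E₁, 0 ≤ x → ‖x‖ ≤ 1 → ‖A (x - u)⁺‖ ≤ ε := by
  by_contra hcon
  push Not at hcon
  choose! c hc0 hc1 hcε using hcon
  -- Each new counterexample is taken against `4 ^ k` times the sum of the previous ones, the
  -- multiple that disjointification requires.
  let s : ℕ → E₁ := fun k => Nat.rec 0 (fun k p => p + c ((4 : ℝ) ^ k • p)) k
  let x : ℕ → E₁ := fun k => c ((4 : ℝ) ^ k • s k)
  have hsum : ∀ k, s k = ∑ i ∈ Finset.range k, x i := by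
    intro k
    induction k with
    | zero => rfl
    | succ k ih => rw [Finset.sum_range_succ, ← ih]
  have hs0 : ∀ k, 0 ≤ s k := by
    intro k
    induction k with
    | zero => exact le_rfl
    | succ k ih => exact add_nonneg ih (hc0 _ (smul_nonneg (by positivity) ih))
  have hs4 : ∀ k, 0 ≤ (4 : ℝ) ^ k • s k := fun k => smul_nonneg (by positivity) (hs0 k)
  have hx0 : ∀ k, 0 ≤ x k := fun k => hc0 _ (hs4 k)
  have hx1 : ∀ k, ‖x k‖ ≤ 1 := fun k => hc1 _ (hs4 k)
  obtain ⟨v, w, hv0, hvx, hvd, hvw⟩ := exists_disjoint_minorant hx0 hx1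
  have hlim := h v hv0 hvd fun k => (norm_le_of_mem ⟨hv0 k, hvx k⟩).trans (hx1 k)
  have hlim2 : Tendsto (fun k => (1 / 2 : ℝ) ^ k * ‖A w‖) atTop (𝓝 0) := by
    simpa using (tendsto_pow_atTop_nhds_zero_of_lt_one (by norm_num)
      (by norm_num : (1 / 2 : ℝ) < 1)).mul_const ‖A w‖
  have hge : ∀ k, ε ≤ ‖A (v k)‖ + (1 / 2 : ℝ) ^ k * ‖A w‖ := by
    intro k
    have e1 : ε < ‖A (x k - (4 : ℝ) ^ k • s k)⁺‖ := hcε _ (hs4 k)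
    rw [hsum] at e1
    have e2 : ‖A (x k - (4 : ℝ) ^ k • ∑ i ∈ Finset.range k, x i)⁺‖ ≤
        ‖A (v k + (1 / 2 : ℝ) ^ k • w)‖ :=
      norm_le_of_mem ⟨fun y hy => hpos _ _ (posPart_nonneg _) hy,
        IsPositiveBilinForm.mono_left hpos (hvw k)⟩
    have e3 : ‖A (v k + (1 / 2 : ℝ) ^ k • w)‖ ≤ ‖A (v k)‖ + (1 / 2 : ℝ) ^ k * ‖A w‖ := by
      rw [map_add, map_smul]
      refine (norm_add_le _ _).trans ?_
      rw [norm_smul, Real.norm_of_nonneg (by positivity)]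
    linarith
  have := ge_of_tendsto' (hlim.add hlim2) hge
  linarith

theorem isNormBoundedSeq_of_isWeakStarNull [CompleteSpace E₁] {f : ℕ → StrongDual ℝ E₁}
    (hf : IsWeakStarNull f) : IsNormBoundedSeq f :=
  banach_steinhaus fun x => by
    obtain ⟨C, hC⟩ := (hf x).norm.bddAbove_range
    exact ⟨C, fun n => hC ⟨n, rfl⟩⟩

theorem comp_nonneg {A : E₁ →L[ℝ] E₂ →L[ℝ] ℝ} (hpos : IsPositiveBilinForm A)
    {g : StrongDual ℝ (StrongDual ℝ E₂)} (hg : 0 ≤ g) : 0 ≤ g.comp A :=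
  fun x hx => hg (A x) fun y hy => hpos x y hx hy

theorem isPositiveBilinForm_aronBernerTransposition {A : E₁ →L[ℝ] E₂ →L[ℝ] ℝ}
    (hpos : IsPositiveBilinForm A) : IsPositiveBilinForm (aronBernerTransposition A) :=
  fun _ _ hf hg => hf _ (comp_nonneg hpos hg)

/-! ### Weak positive limitedness of the first extension -/

variable [CompleteSpace E₁] [CompleteSpace E₂] [IsOrderedModule ℝ E₁] [IsOrderedModule ℝ E₂]

/-- The two clauses use domination in opposite variables. If `g` is weak-star null, domination in
`E₁` makes the norms of `(g n).comp A` tend to `0`. If `f` is weak-star null, domination in `E₂`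
puts all `(g n).comp A` below one fixed functional up to a positive error of small norm. -/
theorem isWeaklyPositivelyLimited_aronBernerTransposition
    (h₁ : HasOrderContinuousNorm (StrongDual ℝ E₁)) (h₂ : HasOrderContinuousNorm (StrongDual ℝ E₂))
    {A : E₁ →L[ℝ] E₂ →L[ℝ] ℝ} (hpos : IsPositiveBilinForm A) (hA : IsAlmostDunfordPettis A) :
    IsWeaklyPositivelyLimited (aronBernerTransposition A) := by
  have hposB := isPositiveBilinForm_aronBernerTransposition hpos
  constructor
  · intro f g hf hg hfn ⟨K, hK⟩
    obtain ⟨M, hM⟩ := isNormBoundedSeq_of_isWeakStarNull hfn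
    have hK0 : 0 ≤ K := (norm_nonneg _).trans (hK 0)
    refine tendsto_zero_of_le_add (fun n => hposB _ _ (hf n) (hg n)) (M * K) fun ε hε => ?_
    obtain ⟨v, hv0, hv⟩ := exists_norm_posPart_sub_le (IsPositiveBilinForm.flip hpos)
      (fun y => tendsto_norm_of_disjoint h₂ h₁ (IsPositiveBilinForm.flip hpos)
        (IsAlmostDunfordPettis.flip hA)) hε
    refine ⟨fun n => f n (K • A.flip v), hfn _, fun n => ?_⟩
    set p := (g n).comp A with hp
    set q := K • A.flip v with hq
    have hAw : ∀ w : E₁, 0 ≤ w → ‖w‖ ≤ 1 → ‖A w‖ ≤ A w v + ε := by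
      intro w hw hw1
      refine norm_le_of_nonneg (fun y hy => hpos w y hw hy)
        (add_nonneg (hpos w v hw hv0) hε.le) fun y hy hy1 => ?_
      have e1 : A w y ≤ A w (v + (y - v)⁺) := IsPositiveBilinForm.mono_right hpos hw
        (by rw [← sub_le_iff_le_add']; exact le_posPart _)
      have e2 : A w (y - v)⁺ ≤ ‖A.flip (y - v)⁺‖ * ‖w‖ :=
        (le_abs_self _).trans ((A.flip (y - v)⁺).le_opNorm w)
      have e3 : ‖A.flip (y - v)⁺‖ * ‖w‖ ≤ ε * 1 := by
        gcongr
        exact hv y hy hy1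
      rw [map_add] at e1
      linarith
    -- By the Riesz-Kantorovich formula it is enough to bound `p - q` on `0 ≤ u ≤ x`; there `hAw`
    -- replaces the norm of `A u` by its value at `v`.
    have hnorm : ‖pos (p - q)‖ ≤ K * ε := by
      refine norm_le_of_nonneg (pos_nonneg _) (by positivity) fun x hx hx1 => ?_
      rw [pos_apply _ hx]
      refine supOn_le _ hx fun u hu hux => ?_
      have e1 := hAw u hu ((norm_le_of_mem ⟨hu, hux⟩).trans hx1)
      have e2 : g n (A u) ≤ K * ‖A u‖ := (le_abs_self _).trans
        (((g n).le_opNorm _).trans (by gcongr; exact hK n))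
      have e3 : K * ‖A u‖ ≤ K * (A u v + ε) := by gcongr
      have e4 : (p - q) u = g n (A u) - K * A u v := rfl
      rw [e4]
      linarith
    have e1 : f n p ≤ f n (q + pos (p - q)) := by
      have : p ≤ q + pos (p - q) := by
        rw [← sub_le_iff_le_add']; exact le_pos _
      simpa using hf n _ (sub_nonneg.2 this)
    have e2 : f n (pos (p - q)) ≤ M * (K * ε) := by
      refine (le_abs_self _).trans (((f n).le_opNorm _).trans ?_)
      have := hM n
      have hM0 : 0 ≤ M := (norm_nonneg _).trans this
      gcongr
    rw [map_add] at e1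
    change f n p ≤ _
    linarith
  · intro f g hf hg ⟨M, hM⟩ hgn
    obtain ⟨K, hK⟩ := isNormBoundedSeq_of_isWeakStarNull hgn
    have hM0 : 0 ≤ M := (norm_nonneg _).trans (hM 0)
    have hK0 : 0 ≤ K := (norm_nonneg _).trans (hK 0)
    refine tendsto_zero_of_le_add (fun n => hposB _ _ (hf n) (hg n)) (M * K) fun ε hε => ?_
    obtain ⟨u, hu0, hu⟩ := exists_norm_posPart_sub_le hpos
      (fun y => tendsto_norm_of_disjoint h₁ h₂ hpos hA) hε
    refine ⟨fun n => M * g n (A u), by simpa using (hgn (A u)).const_mul M, fun n => ?_⟩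
    have hAu : 0 ≤ g n (A u) := hg n _ fun y hy => hpos u y hu0 hy
    have hnorm : ‖(g n).comp A‖ ≤ g n (A u) + K * ε := by
      refine norm_le_of_nonneg (comp_nonneg hpos (hg n)) (by positivity) fun x hx hx1 => ?_
      have e1 : A x ≤ A (u + (x - u)⁺) := IsPositiveBilinForm.mono_left hpos
        (by rw [← sub_le_iff_le_add']; exact le_posPart _)
      have e2 : g n (A x) ≤ g n (A (u + (x - u)⁺)) := by
        simpa using hg n _ (sub_nonneg.2 e1)
      have e3 : g n (A (x - u)⁺) ≤ K * ε := by
        refine (le_abs_self _).trans (((g n).le_opNorm _).trans ?_)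
        gcongr
        · exact hK n
        · exact hu x hx hx1
      rw [map_add, map_add] at e2
      change g n (A x) ≤ _
      linarith
    calc f n ((g n).comp A) ≤ ‖f n‖ * ‖(g n).comp A‖ :=
          (le_abs_self _).trans ((f n).le_opNorm _)
      _ ≤ M * (g n (A u) + K * ε) := by
          gcongr
          exact hM n
      _ = _ := by ring

end Bilinear

/-! ### Moduli of disjoint weakly null sequences -/

theorem abs_smul_of_nonneg {E : Type*} [NormedAddCommGroup E] [NormedSpace ℝ E] [Lattice E]
    [IsOrderedModule ℝ E] {c : ℝ} (hc : 0 ≤ c) (x : E) :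
    |c • x| = c • |x| := by
  rcases hc.eq_or_lt with rfl | hc
  · simp [abs]
  · have h : c • (x ⊔ -x) = c • x ⊔ c • -x := (OrderIso.smulRight hc).map_sup x (-x)
    rw [abs, abs, h, smul_neg]

/-- Positive functionals tend to `0` along the absolute values of a disjoint weakly null sequence. -/
theorem tendsto_abs_of_isWeaklyNull {E : Type*} [NormedAddCommGroup E] [NormedSpace ℝ E] [Lattice E]
    [IsOrderedAddMonoid E] [HasSolidNorm E] [IsOrderedModule ℝ E] {x : ℕ → E}
    (hd : IsDisjointSeq x) (hx : IsWeaklyNull x) {f : StrongDual ℝ E} (hf : 0 ≤ f) :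
    Tendsto (fun n => f |x n|) atTop (𝓝 0) := by
  by_contra hcon
  rw [Metric.tendsto_atTop] at hcon
  push Not at hcon
  obtain ⟨ε, hε, hcon⟩ := hcon
  -- Convex combinations of these disjoint terms satisfy `f |∑ aᵢ xᵢ| ≥ ∑ aᵢ f |xᵢ| ≥ ε`, so their
  -- norms stay away from `0`. Hahn-Banach then separates `0` from the closed convex hull,
  -- contradicting weak nullness.
  let v : {n // ε ≤ f |x n|} → E := fun n => x n
  have hmem : convexHull ℝ (Set.range v) ⊆ {z | ε ≤ ‖f‖ * ‖z‖} := by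
    rw [convexHull_range_eq_exists_affineCombination]
    rintro _ ⟨s, a, ha0, ha1, rfl⟩
    rw [s.affineCombination_eq_linear_combination _ _ ha1]
    have habs : ∀ i ∈ s, |a i • v i| = a i • |v i| := fun i hi => abs_smul_of_nonneg (ha0 i hi) _
    have hle : ∀ i ∈ s, |a i • v i| ≤ |v i| := fun i hi => by
      rw [habs i hi]
      have h1 : a i ≤ 1 := ha1 ▸ Finset.single_le_sum ha0 hi
      simpa using smul_le_smul_of_nonneg_right h1 (abs_nonneg (v i))
    have h1 : ∑ i ∈ s, |a i • v i| ≤ |∑ i ∈ s, a i • v i| :=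
      sum_abs_le_abs_sum s _ fun i hi j hj hij =>
        inf_eq_zero_of_le (abs_nonneg _) (abs_nonneg _) (hle i hi) (hle j hj)
          (hd i j fun h => hij (Subtype.ext h))
    have h2 : f (∑ i ∈ s, |a i • v i|) ≤ f |∑ i ∈ s, a i • v i| := by
      simpa using hf _ (sub_nonneg.2 h1)
    calc ε = ∑ i ∈ s, a i * ε := by rw [← Finset.sum_mul, ha1, one_mul]
      _ ≤ ∑ i ∈ s, a i * f |v i| :=
          Finset.sum_le_sum fun i hi => mul_le_mul_of_nonneg_left i.2 (ha0 i hi)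
      _ = f (∑ i ∈ s, |a i • v i|) := by
          rw [map_sum]
          refine Finset.sum_congr rfl fun i hi => ?_
          rw [habs i hi, map_smul, smul_eq_mul]
      _ ≤ ‖f‖ * ‖∑ i ∈ s, a i • v i‖ := by
          exact h2.trans (apply_le f (norm_abs_eq_norm _).le)
  have hclosed : IsClosed {z : E | ε ≤ ‖f‖ * ‖z‖} :=
    isClosed_le continuous_const (continuous_const.mul continuous_norm)
  have h0 : (0 : E) ∉ closure (convexHull ℝ (Set.range v)) := fun h => by
    have := closure_minimal hmem hclosed h
    exact hε.not_ge (by simpa using this)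
  obtain ⟨g, u, hu, hg⟩ := geometric_hahn_banach_point_closed
    (convex_convexHull ℝ (Set.range v)).closure isClosed_closure h0
  rw [map_zero] at hu
  obtain ⟨N, hN⟩ := ((hx g).eventually_lt_const hu).exists_forall_of_atTop
  obtain ⟨n, hn, hnε⟩ := hcon N
  rw [Real.dist_eq, sub_zero, abs_of_nonneg (hf _ (abs_nonneg _))] at hnε
  exact lt_asymm (hN n hn) (hg _ (subset_closure (subset_convexHull ℝ _ ⟨⟨n, hnε⟩, rfl⟩)))

/-- Disjoint weakly null sequences in the bidual have weak-star null absolute values. -/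
theorem isWeakStarNull_abs {E : Type*} [NormedAddCommGroup E] [NormedSpace ℝ E] [Lattice E]
    [IsOrderedAddMonoid E] [HasSolidNorm E] {x : ℕ → StrongDual ℝ (StrongDual ℝ E)}
    (hd : IsDisjointSeq x) (hx : IsWeaklyNull x) : IsWeakStarNull fun n => |x n| := by
  have key : ∀ f : StrongDual ℝ E, 0 ≤ f → Tendsto (fun n => |x n| f) atTop (𝓝 0) := fun f hf =>
    tendsto_abs_of_isWeaklyNull (f := ContinuousLinearMap.apply ℝ ℝ f) hd hx fun y hy => hy f hf
  intro f
  have h := (key _ (posPart_nonneg f)).sub (key _ (negPart_nonneg f))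
  rw [sub_zero] at h
  refine h.congr fun n => ?_
  rw [← map_sub, posPart_sub_negPart]

/-! ### From weakly positively limited to almost Dunford-Pettis -/

section Bilinear

variable {E₁ E₂ : Type*}
  [NormedAddCommGroup E₁] [NormedSpace ℝ E₁] [Lattice E₁] [IsOrderedAddMonoid E₁]
  [HasSolidNorm E₁]
  [NormedAddCommGroup E₂] [NormedSpace ℝ E₂] [Lattice E₂] [IsOrderedAddMonoid E₂]
  [HasSolidNorm E₂]

theorem IsPositiveBilinForm.abs_apply_le {A : E₁ →L[ℝ] E₂ →L[ℝ] ℝ} (h : IsPositiveBilinForm A)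
    (x : E₁) (y : E₂) : |A x y| ≤ A |x| |y| := by
  refine (BanachLatticeDual.abs_apply_le (A x) y).trans ?_
  have h1 : |A x| ≤ A |x| := by
    refine abs_le'.2 ⟨IsPositiveBilinForm.mono_left h (le_abs_self x), ?_⟩
    rw [← map_neg]
    exact IsPositiveBilinForm.mono_left h (neg_le_abs x)
  exact h1 _ (abs_nonneg y)

/-- Positivity reduces to the moduli, which are weak-star null in both variables; in the second
variable only the resulting norm boundedness is needed. -/
theorem IsWeaklyPositivelyLimited.isAlmostDunfordPettis [CompleteSpace E₁] [CompleteSpace E₂]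
    {B : StrongDual ℝ (StrongDual ℝ E₁) →L[ℝ] StrongDual ℝ (StrongDual ℝ E₂) →L[ℝ] ℝ}
    (hpos : IsPositiveBilinForm B) (hB : IsWeaklyPositivelyLimited B) :
    IsAlmostDunfordPettis B := fun x y hxd hx hyd hy =>
  squeeze_zero_norm (fun n => IsPositiveBilinForm.abs_apply_le hpos (x n) (y n))
    (hB.1 _ _ (fun _ => abs_nonneg _) (fun _ => abs_nonneg _) (isWeakStarNull_abs hxd hx)
      (isNormBoundedSeq_of_isWeakStarNull (isWeakStarNull_abs hyd hy)))

theorem IsWeaklyPositivelyLimited.flip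
    {B : StrongDual ℝ E₁ →L[ℝ] StrongDual ℝ E₂ →L[ℝ] ℝ}
    (hB : IsWeaklyPositivelyLimited B) : IsWeaklyPositivelyLimited B.flip :=
  ⟨fun f g hf hg hf' hg' => hB.2 g f hg hf hg' hf', fun f g hf hg hf' hg' => hB.1 g f hg hf hg' hf'⟩

end Bilinear

end BanachLatticeDual

open BanachLatticeDual

theorem theorem3p7 {E₁ E₂ : Type*}
    [NormedAddCommGroup E₁] [NormedSpace ℝ E₁] [CompleteSpace E₁] [Lattice E₁]
    [IsOrderedAddMonoid E₁] [IsOrderedModule ℝ E₁] [HasSolidNorm E₁]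
    [NormedAddCommGroup E₂] [NormedSpace ℝ E₂] [CompleteSpace E₂] [Lattice E₂]
    [IsOrderedAddMonoid E₂] [IsOrderedModule ℝ E₂] [HasSolidNorm E₂]
    (h₁ : HasOrderContinuousNorm (StrongDual ℝ E₁))
    (h₂ : HasOrderContinuousNorm (StrongDual ℝ E₂))
    (A : E₁ →L[ℝ] E₂ →L[ℝ] ℝ) (hpos : IsPositiveBilinForm A) (hA : IsAlmostDunfordPettis A) :
    (IsWeaklyPositivelyLimited (aronBernerTransposition A) ∧
      IsWeaklyPositivelyLimited (aronBernerIdentity A)) ∧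
    (IsAlmostDunfordPettis (aronBernerTransposition A) ∧
      IsAlmostDunfordPettis (aronBernerIdentity A)) := by
  have hpos' := IsPositiveBilinForm.flip hpos
  have h := isWeaklyPositivelyLimited_aronBernerTransposition h₁ h₂ hpos hA
  -- The hypotheses are symmetric in the two variables, and `aronBernerIdentity A` unfolds to the
  -- flip of the transposition extension of `A.flip`.
  have h' := isWeaklyPositivelyLimited_aronBernerTransposition h₂ h₁ hpos'
    (IsAlmostDunfordPettis.flip hA)
  have hp := isPositiveBilinForm_aronBernerTransposition hpos
  have hp' := isPositiveBilinForm_aronBernerTransposition hpos'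
  exact ⟨⟨h, IsWeaklyPositivelyLimited.flip h'⟩,
    IsWeaklyPositivelyLimited.isAlmostDunfordPettis hp h,
    IsAlmostDunfordPettis.flip (IsWeaklyPositivelyLimited.isAlmostDunfordPettis hp' h')⟩
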